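/- A polynomial $f\in\mathbb{Q}[x]$ \emph{represents integers} if $f(a)\in\mathbb{Z}$ for some $a\in\mathbb{Z}$; it \emph{represents primes} if it is non-constant and irreducible over $\mathbb{Q}$ with positive leading coefficient, represents integers, and $\gcd\{f(a)\in\mathbb{Z} : a\in\mathbb{Z}\}=1$. Let $k$ be a positive integer and $D$ a square-free positive integer. A triple $(t,r,q)\in\mathbb{Q}[x]^3$ is a \emph{cyclotomic family} of elliptic curves with embedding degree $k$ and CM discriminant $D$ if it is produced by the Brezing--Weng construction with $r$ a cyclotomic polynomial, that is: $r=\Phi_N$ for some $N\ge 1$ with $k\mid N$; the field $K=\mathbb{Q}[x]/(r)$ contains a primitive $k$-th root of unity $\eta$ and a square root $s$ of $-D$ such that $t$ is the polynomial of degree less than $\deg r$ mapping to $\eta+1$ in $K$, and $q=(t^2+Dy^2)/4$, where $y\in\mathbb{Q}[x]$ is the polynomial of degree less than $\deg r$ mapping to $(\eta-1)/s$ in $K$; and $q$ represents primes while $t$ and $y$ represent integers. The $\rho$-value of the family is $\rho(t,r,q)=\deg q/\deg r$. \textbf{Theorem.} Let $k=2^mp^n$ with $p$ an odd prime and integers $m,n\ge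 0$, and let $D$ be a square-free positive integer. If $(t,r,q)$ is a cyclotomic family of elliptic curves with $r=\Phi_k$, embedding degree $k$ and CM discriminant $D$, then $\rho(t,r,q)\neq 1$; that is, no such family is ideal. -/

import Mathlib

namespace PairingFriendly

open Polynomial

/-- `f ∈ ℚ[x]` represents integers: it takes an integer value at some integer. -/
def RepresentsIntegers (f : ℚ[X]) : Prop :=
  ∃ x n : ℤ, f.eval (x : ℚ) = (n : ℚ)

/-- `f ∈ ℚ[x]` represents primes: it is non-constant and irreducible with positive leading
coefficient, it represents integers, and the integer values which it takes at integers have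
greatest common divisor one (the units are the only common divisors of these values). -/
structure RepresentsPrimes (f : ℚ[X]) : Prop where
  nonconstant : 0 < f.natDegree
  irreducible : Irreducible f
  leadingCoeff_pos : 0 < f.leadingCoeff
  representsIntegers : RepresentsIntegers f
  gcd_eq_one : ∀ d : ℤ, (∀ x n : ℤ, f.eval (x : ℚ) = (n : ℚ) → d ∣ n) → IsUnit d

/-- `(t, r, q)` is a family of elliptic curves with embedding degree `k` and CM discriminant `D`
produced by the Brezing–Weng construction:
* `r` is a non-constant irreducible polynomial in `ℤ[x]` with positive leading coefficient, and
  `K = ℚ[x]/(r)` contains a primitive `k`-th root of unity `η` and a square root `s` of `-D`;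
* `t` and `y` are the polynomials of degree less than `deg r` which map to `η + 1` and to
  `(η - 1) / s` in `K` (note that `s ≠ 0` as `D ≠ 0`), and `q = (t ^ 2 + D y ^ 2) / 4`;
* `q` represents primes, and `t` and `y` represent integers. -/
structure IsBrezingWengFamily (k D : ℕ) (t r q : ℚ[X]) : Prop where
  k_pos : 0 < k
  squarefree_D : Squarefree D
  r_integral : ∃ R : ℤ[X], R.map (Int.castRingHom ℚ) = r ∧ 0 < R.natDegree ∧
    Irreducible R ∧ 0 < R.leadingCoeff
  q_representsPrimes : RepresentsPrimes q
  t_representsIntegers : RepresentsIntegers t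
  construction : ∃ (η s : AdjoinRoot r) (y : ℚ[X]),
    IsPrimitiveRoot η k ∧ s ^ 2 = -(D : AdjoinRoot r) ∧
    AdjoinRoot.mk r t = η + 1 ∧ t.degree < r.degree ∧
    AdjoinRoot.mk r y * s = η - 1 ∧ y.degree < r.degree ∧
    q = C (1 / 4 : ℚ) * (t ^ 2 + C (D : ℚ) * y ^ 2) ∧
    RepresentsIntegers y

/-- A cyclotomic family with embedding degree `k` and CM discriminant `D`: the outcome of the
Brezing–Weng construction for a cyclotomic polynomial `r = Φ_n` with `k ∣ n`. -/
def IsCyclotomicFamily (k D : ℕ) (t r q : ℚ[X]) : Prop :=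
  IsBrezingWengFamily k D t r q ∧ ∃ n : ℕ, 0 < n ∧ k ∣ n ∧ r = cyclotomic n ℚ

/-- The `ρ`-value `deg q / deg r` of a family `(t, r, q)`. -/
def rhoValue (_t r q : ℚ[X]) : ℚ :=
  (q.natDegree : ℚ) / (r.natDegree : ℚ)

end PairingFriendly

namespace PairingFriendly

open Polynomial ComplexConjugate

/-! ### Polynomial relations at a root of unity, and degree bounds -/

section CyclotomicRelations

variable {k : ℕ} {ζ : ℂ}

/-! Suppose ρ = 1 and φ(k) = 2d. As D > 0, leading terms of `t ^ 2 + D y ^ 2` cannot cancel, so t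
and y have degree at most d. Then t - 1 represents a primitive k-th root of unity in low degree,
which forces t - 1 = ±X^e with e ≤ d (`eq_signed_monomial`). Put u = t - 2, so u(ζ) = s y(ζ) and u²
+ Dy² = cΦ_k.

Comparing this representation with its reciprocal gives e = d and makes y symmetric up to sign
(`eq_and_reflect_of_binomial`). But e is prime to N, where N is k or k/2, and this leaves only k = p
or 2p with p = 2d + 1 ≥ 5 (`exists_half_modulus`). There the extreme coefficients of the factor u +
sy of cΦ_k differ by a root of unity, which forces y to have degree below d. The coefficient of
X^(p-2) in u² + Dy² then vanishes, while that of Φ_k is nonzero.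

The cases φ(k) ≤ 2 are separate: t and y are constant, or q has a rational root. -/

theorem exists_eq_C_mul_cyclotomic (hζ : IsPrimitiveRoot ζ k) (hk : 0 < k) {P : ℚ[X]}
    (hdeg : P.natDegree ≤ k.totient) (h0 : aeval ζ P = 0) :
    ∃ a : ℚ, P = C a * cyclotomic k ℚ := by
  have hdvd : cyclotomic k ℚ ∣ P := by
    rw [cyclotomic_eq_minpoly_rat hζ hk]
    exact minpoly.dvd ℚ ζ h0
  obtain ⟨g, rfl⟩ := hdvd
  rcases eq_or_ne g 0 with rfl | hg
  · exact ⟨0, by simp⟩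
  · rw [natDegree_mul (cyclotomic_ne_zero k ℚ) hg, natDegree_cyclotomic] at hdeg
    rw [eq_C_of_natDegree_eq_zero (p := g) (by lia)]
    exact ⟨g.coeff 0, mul_comm _ _⟩

theorem eq_zero_of_aeval_primitiveRoot_eq_zero (hζ : IsPrimitiveRoot ζ k) (hk : 0 < k) {P : ℚ[X]}
    (hdeg : P.natDegree < k.totient) (h0 : aeval ζ P = 0) : P = 0 := by
  obtain ⟨a, rfl⟩ := exists_eq_C_mul_cyclotomic hζ hk hdeg.le h0
  rcases eq_or_ne a 0 with rfl | ha
  · simp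
  · rw [natDegree_C_mul ha, natDegree_cyclotomic] at hdeg
    exact absurd hdeg (lt_irrefl _)

theorem aeval_conj_rat (P : ℚ[X]) (z : ℂ) : aeval (conj z) P = conj (aeval z P) := by
  simp [aeval_eq_sum_range, Algebra.smul_def]

theorem aeval_reflect_primitiveRoot (hζ : IsPrimitiveRoot ζ k) (hk : 0 < k) {P : ℚ[X]} {d : ℕ}
    (hP : P.natDegree ≤ d) : aeval ζ (reflect d P) = ζ ^ d * conj (aeval ζ P) := by
  have hz : ζ ≠ 0 := hζ.ne_zero hk.ne'
  have hinv : ζ⁻¹ = conj ζ := Complex.inv_eq_conj (hζ.norm'_eq_one hk.ne')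
  let _ : Invertible ζ⁻¹ := invertibleOfNonzero (inv_ne_zero hz)
  have h := eval₂_reflect_mul_pow (algebraMap ℚ ℂ) ζ⁻¹ d P hP
  rw [invOf_eq_inv, inv_inv] at h
  rw [← aeval_conj_rat, ← hinv, aeval_def, aeval_def, ← h, mul_comm, mul_assoc, ← mul_pow,
    inv_mul_cancel₀ hz, one_pow, mul_one]

theorem conj_eq_neg_of_sq {s : ℂ} {D : ℕ} (hs : s ^ 2 = -(D : ℂ)) (hD : 0 < D) :
    conj s = -s := by
  have hre := congrArg Complex.re hs
  have him := congrArg Complex.im hs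
  simp only [pow_two, Complex.mul_re, Complex.mul_im, Complex.neg_re, Complex.neg_im,
    Complex.natCast_re, Complex.natCast_im] at hre him
  have hD' : (0 : ℝ) < D := by exact_mod_cast hD
  have h0 : s.re = 0 := by
    by_contra h
    have : s.im = 0 := by
      have : s.re * s.im = 0 := by linarith
      exact (mul_eq_zero.mp this).resolve_left h
    rw [this] at hre
    nlinarith [sq_nonneg s.re]
  apply Complex.ext <;> simp [h0]

end CyclotomicRelations

theorem natDegree_le_of_natDegree_sq_add_le {D d : ℕ} (hD : 0 < D) {t y : ℚ[X]}
    (h : (t ^ 2 + C (D : ℚ) * y ^ 2).natDegree ≤ 2 * d) :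
    t.natDegree ≤ d ∧ y.natDegree ≤ d := by
  by_contra hcon
  set M := max t.natDegree y.natDegree with hM
  have hMd : d < M := by
    rw [not_and_or, not_le, not_le] at hcon
    exact lt_max_iff.mpr hcon
  have hc : (t ^ 2 + C (D : ℚ) * y ^ 2).coeff (2 * M) = 0 :=
    coeff_eq_zero_of_natDegree_lt (by lia)
  rw [coeff_add, coeff_C_mul, coeff_pow_of_natDegree_le (le_max_left _ _),
    coeff_pow_of_natDegree_le (le_max_right _ _)] at hc
  have hD' : (0 : ℚ) < D := by exact_mod_cast hD
  have ht : t.coeff M = 0 := by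
    by_contra h0
    have := sq_pos_of_ne_zero h0
    have := mul_nonneg hD'.le (sq_nonneg (y.coeff M))
    linarith
  have hy : y.coeff M = 0 := by
    by_contra h0
    have := mul_pos hD' (sq_pos_of_ne_zero h0)
    have := sq_nonneg (t.coeff M)
    linarith
  rcases max_choice t.natDegree y.natDegree with h1 | h1 <;> rw [← hM] at h1
  · rw [h1, coeff_natDegree, leadingCoeff_eq_zero] at ht
    rw [ht, natDegree_zero] at h1
    lia
  · rw [h1, coeff_natDegree, leadingCoeff_eq_zero] at hy
    rw [hy, natDegree_zero] at h1
    lia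

theorem eq_zero_of_sq_add_eq_zero {D : ℕ} {u y : ℚ[X]}
    (h : u ^ 2 + C (D : ℚ) * y ^ 2 = 0) : u = 0 := by
  refine funext fun x => ?_
  have := congrArg (eval x) h
  simp only [eval_add, eval_mul, eval_pow, eval_C, eval_zero] at this ⊢
  have h2 : (0 : ℚ) ≤ D * (eval x y) ^ 2 := by positivity
  exact pow_eq_zero_iff two_ne_zero |>.mp (by nlinarith [sq_nonneg (eval x u)])

/-! ### Reciprocal polynomials and the symmetry of y -/

section Reciprocity

variable {k d D : ℕ} {ζ s : ℂ} {u y : ℚ[X]}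

/-- A representation of a multiple of `Φ_k` by the form `u ^ 2 + D y ^ 2` is unique up to a
rational similitude; applied here to the representation and its reciprocal. -/
theorem exists_reflect_relation (hζ : IsPrimitiveRoot ζ k) (hk : 0 < k)
    (hφ : k.totient = 2 * d) (hD : 0 < D) (hs : s ^ 2 = -(D : ℂ))
    (hu : u.natDegree ≤ d) (hy : y.natDegree ≤ d) (huy : aeval ζ u = s * aeval ζ y)
    (hu0 : u ≠ 0) :
    ∃ a b c : ℚ, c ≠ 0 ∧ u ^ 2 + C (D : ℚ) * y ^ 2 = C c * cyclotomic k ℚ ∧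
      u * reflect d y + reflect d u * y = C b * cyclotomic k ℚ ∧
      C c * reflect d u = C a * u + C (D * b) * y := by
  have hru : (reflect d u).natDegree ≤ d := natDegree_reflect_le.trans (by simp [hu])
  have hry : (reflect d y).natDegree ≤ d := natDegree_reflect_le.trans (by simp [hy])
  have hmul : ∀ {f g : ℚ[X]}, f.natDegree ≤ d → g.natDegree ≤ d →
      (f * g).natDegree ≤ k.totient := fun hf hg => by
    rw [hφ, two_mul]; exact natDegree_mul_le_of_le hf hg
  have hCmul : ∀ {f g : ℚ[X]}, f.natDegree ≤ d → g.natDegree ≤ d →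
      (C (D : ℚ) * (f * g)).natDegree ≤ k.totient := fun hf hg =>
    (natDegree_C_mul_le _ _).trans (hmul hf hg)
  -- Reflection acts at ζ as conjugation up to the factor ζ^d, and conjugation negates s.
  have hrel : aeval ζ (reflect d u) = -s * aeval ζ (reflect d y) := by
    rw [aeval_reflect_primitiveRoot hζ hk hu, aeval_reflect_primitiveRoot hζ hk hy, huy, map_mul,
      conj_eq_neg_of_sq hs hD]
    ring
  obtain ⟨c, hc⟩ := exists_eq_C_mul_cyclotomic hζ hk (P := u ^ 2 + C (D : ℚ) * y ^ 2)
    (natDegree_add_le_of_degree_le (by rw [pow_two]; exact hmul hu hu)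
      (by rw [pow_two]; exact hCmul hy hy))
    (by
      simp only [map_add, map_mul, map_pow, huy, map_natCast]
      linear_combination (aeval ζ y) ^ 2 * hs)
  obtain ⟨b, hb⟩ := exists_eq_C_mul_cyclotomic hζ hk (P := u * reflect d y + reflect d u * y)
    (natDegree_add_le_of_degree_le (hmul hu hry) (hmul hru hy))
    (by
      simp only [map_add, map_mul, huy, hrel]
      ring)
  obtain ⟨a, ha⟩ := exists_eq_C_mul_cyclotomic hζ hk
    (P := u * reflect d u - C (D : ℚ) * (y * reflect d y))
    ((natDegree_sub_le_of_le (hmul hu hru) (hCmul hy hry)).trans_eq (max_self _))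
    (by
      simp only [map_sub, map_mul, huy, hrel, map_natCast]
      linear_combination -(aeval ζ y) * (aeval ζ (reflect d y)) * hs)
  refine ⟨a, b, c, ?_, hc, hb, ?_⟩
  · rintro rfl
    exact hu0 (eq_zero_of_sq_add_eq_zero (by simpa using hc))
  -- Writing u', y' for the reflections: (u² + Dy²)u' = u(uu' - Dyy') + Dy(uy' + u'y); then Φ_k
  -- cancels.
  · refine mul_right_cancel₀ (cyclotomic_ne_zero k ℚ) ?_
    rw [C_mul]
    linear_combination (-reflect d u) * hc + u * ha + C (D : ℚ) * y * hb

/-- Otherwise u would divide the irreducible Φ_k while having degree strictly between 0 and φ(k). -/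
theorem not_dvd_of_sq_add_eq (hk : 0 < k) {c : ℚ} (hc : c ≠ 0)
    (h : u ^ 2 + C (D : ℚ) * y ^ 2 = C c * cyclotomic k ℚ) (hu : 0 < u.natDegree)
    (hlt : u.natDegree < k.totient) : ¬ u ∣ y := by
  rintro ⟨g, rfl⟩
  have hdvd : u ∣ cyclotomic k ℚ := by
    have : u ∣ C c * cyclotomic k ℚ := by
      rw [← h]; exact ⟨u + C (D : ℚ) * (u * g ^ 2), by ring⟩
    exact ((isUnit_C.mpr (isUnit_iff_ne_zero.mpr hc)).dvd_mul_left).mp this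
  rcases (cyclotomic.irreducible_rat hk).dvd_iff.mp hdvd with h1 | h1
  · exact hu.ne' (natDegree_eq_zero_of_isUnit h1)
  · have := natDegree_eq_of_degree_eq (degree_eq_degree_of_associated h1)
    rw [natDegree_cyclotomic] at this
    lia

theorem reflect_binomial {e : ℕ} (he : e ≤ d) {ε : ℚ} (hε : ε ^ 2 = 1) :
    reflect d (C ε * X ^ e - 1) = -C ε * X ^ (d - e) * (C ε * X ^ e - 1) := by
  have h1 : C ε * C ε = (1 : ℚ[X]) := by rw [← C_mul, ← pow_two, hε, C_1]
  rw [reflect_sub, reflect_C_mul_X_pow, reflect_one, revAt_le he]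
  have h2 : (X : ℚ[X]) ^ d = X ^ (d - e) * X ^ e := by rw [← pow_add, Nat.sub_add_cancel he]
  rw [h2]
  linear_combination (X ^ (d - e) * X ^ e) * h1

theorem natDegree_binomial {e : ℕ} {ε : ℚ} (hε : ε ≠ 0) (he : 0 < e) :
    (C ε * X ^ e - 1 : ℚ[X]).natDegree = e := by
  rw [natDegree_sub_eq_left_of_natDegree_lt] <;> rw [natDegree_C_mul_X_pow _ _ hε]
  simpa using he

/-- If `u = ± X ^ e - 1`, then `u` has the maximal possible degree and `y` has the same symmetry
as `-u`. -/
theorem eq_and_reflect_of_binomial (hζ : IsPrimitiveRoot ζ k) (hk : 0 < k)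
    (hφ : k.totient = 2 * d) (hD : 0 < D) (hs : s ^ 2 = -(D : ℂ)) {e : ℕ} {ε : ℚ}
    (he : 0 < e) (hed : e ≤ d) (hε : ε ^ 2 = 1) (hy : y.natDegree ≤ d)
    (huy : aeval ζ (C ε * X ^ e - 1 : ℚ[X]) = s * aeval ζ y) :
    e = d ∧ reflect d y = C ε * y ∧
      ∃ c : ℚ, c ≠ 0 ∧ (C ε * X ^ e - 1) ^ 2 + C (D : ℚ) * y ^ 2 = C c * cyclotomic k ℚ := by
  have hε0 : ε ≠ 0 := by rintro rfl; norm_num at hε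
  have hdeg := natDegree_binomial hε0 he
  have hrefl := reflect_binomial hed hε
  set u : ℚ[X] := C ε * X ^ e - 1 with hu
  have hu0 : u ≠ 0 := by rintro h0; rw [h0, natDegree_zero] at hdeg; lia
  obtain ⟨a, b, c, hc, h1, h2, h3⟩ :=
    exists_reflect_relation hζ hk hφ hD hs (hdeg.trans_le hed) hy huy hu0
  have hnd := not_dvd_of_sq_add_eq hk hc h1 (by lia) (by lia)
  have hD' : (D : ℚ) ≠ 0 := by exact_mod_cast hD.ne'
  -- The reflection of u is a multiple of u, so b ≠ 0 would make u divide y.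
  have hb : b = 0 := by
    by_contra hb
    refine hnd ?_
    have : u ∣ C (D * b) * y := ⟨C c * (-C ε * X ^ (d - e)) - C a, by
      rw [hrefl] at h3; linear_combination -h3⟩
    exact ((isUnit_C.mpr (isUnit_iff_ne_zero.mpr (mul_ne_zero hD' hb))).dvd_mul_left).mp this
  subst hb
  have hX : C (-(c * ε)) * X ^ (d - e) = C a := by
    refine mul_right_cancel₀ hu0 ?_
    rw [hrefl] at h3
    simp only [mul_zero, C_0, zero_mul, add_zero] at h3
    rw [C_neg, C_mul]
    linear_combination h3
  have hde : d - e = 0 := by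
    have := congrArg natDegree hX
    rwa [natDegree_C_mul_X_pow _ _ (neg_ne_zero.mpr (mul_ne_zero hc hε0)), natDegree_C] at this
  refine ⟨by lia, ?_, c, hc, h1⟩
  refine mul_left_cancel₀ hu0 ?_
  rw [hrefl, hde] at h2
  simp only [C_0, zero_mul, pow_zero] at h2
  linear_combination h2

end Reciprocity

/-! ### Excluding k = p and k = 2p by comparing coefficients -/

/-- The relation is a rational quadratic equation for w with constant term 1 + g > 0, so the order
of w has totient at most 2. As p - 1 ≥ 4, p does not divide that order, which therefore divides 2.
-/
theorem sq_eq_one_of_quadratic {p : ℕ} (hp : p.Prime) (hp5 : 5 ≤ p) {w : ℂ}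
    (hw : w ^ (2 * p) = 1) {g ε : ℚ} (hg : 0 ≤ g) (hε : ε ^ 2 = 1)
    (h : (w + ε) ^ 2 = -(g : ℂ) * (w - ε) ^ 2) : w ^ 2 = 1 := by
  have ho : IsPrimitiveRoot w (orderOf w) := IsPrimitiveRoot.orderOf w
  have hdvd : orderOf w ∣ 2 * p := orderOf_dvd_of_pow_eq_one hw
  have hpos : 0 < orderOf w := Nat.pos_of_dvd_of_pos hdvd (by lia)
  have hφ : (orderOf w).totient ≤ 2 := by
    by_contra hlt
    have hε' : (ε : ℂ) ^ 2 = 1 := by exact_mod_cast hε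
    have h0 := eq_zero_of_aeval_primitiveRoot_eq_zero ho hpos
      (P := C (1 + g) * X ^ 2 + C (2 * ε * (1 - g)) * X + C (1 + g))
      (natDegree_quadratic_le.trans_lt (not_le.mp hlt)) (by
        simp only [map_add, map_mul, map_pow, aeval_X, aeval_C, eq_ratCast]
        push_cast
        linear_combination h - (1 + (g : ℂ)) * hε')
    have := congrArg (coeff · 0) h0
    simp at this
    linarith
  have hnd : ¬ p ∣ orderOf w := fun hpd => by
    have := Nat.le_of_dvd (Nat.totient_pos.mpr hpos) (Nat.totient_dvd_of_dvd hpd)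
    rw [Nat.totient_prime hp] at this
    lia
  have hcop : (orderOf w).Coprime p := ((Nat.Prime.coprime_iff_not_dvd hp).mpr hnd).symm
  exact orderOf_dvd_iff_pow_eq_one.mp (hcop.dvd_of_dvd_mul_right hdvd)

/-- Up to a scalar, Φ_k is the geometric sum of the (κX)^i for i < p: since p is odd, (κζ)^p =
κ^(p+1) = 1. -/
theorem cyclotomic_coeff_sub_two_ne_zero {k p : ℕ} {ζ : ℂ} (hζ : IsPrimitiveRoot ζ k)
    (hk : 2 < k) (hodd : Odd p) (hp2 : 2 ≤ p) (hφ : k.totient = p - 1) {κ : ℚ}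
    (hκ : κ ^ 2 = 1) (hζp : ζ ^ p = κ) : (cyclotomic k ℚ).coeff (p - 2) ≠ 0 := by
  have hκ' : (κ : ℂ) ^ 2 = 1 := by exact_mod_cast hκ
  have hκ0 : κ ≠ 0 := by rintro rfl; norm_num at hκ
  have hP : (∑ i ∈ Finset.range p, C (κ ^ i) * X ^ i : ℚ[X]).natDegree ≤ k.totient := by
    refine natDegree_sum_le_of_forall_le _ _ fun i hi => ?_
    refine (natDegree_C_mul_X_pow_le _ _).trans ?_
    have := Finset.mem_range.mp hi
    lia
  obtain ⟨a, ha⟩ := exists_eq_C_mul_cyclotomic hζ (by lia) hP (by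
    simp only [map_sum, map_mul, map_pow, aeval_X, aeval_C, eq_ratCast, ← mul_pow]
    have hne : (κ : ℂ) * ζ - 1 ≠ 0 := by
      intro h1
      have h2 : ζ ^ 2 = 1 := by
        have h3 : (κ : ℂ) * ζ = 1 := sub_eq_zero.mp h1
        calc ζ ^ 2 = (κ : ℂ) ^ 2 * ζ ^ 2 := by rw [hκ', one_mul]
          _ = 1 := by rw [← mul_pow, h3, one_pow]
      have := Nat.le_of_dvd two_pos (hζ.dvd_of_pow_eq_one _ h2)
      lia
    refine (mul_eq_zero.mp (geom_sum_mul ((κ : ℂ) * ζ) p ▸ ?_ :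
      (∑ i ∈ Finset.range p, ((κ : ℂ) * ζ) ^ i) * ((κ : ℂ) * ζ - 1) = 0)).resolve_right hne
    rw [mul_pow, hζp, ← pow_succ, (hodd.add_odd odd_one).two_dvd.choose_spec, pow_mul, hκ',
      one_pow, sub_self])
  intro h0
  have := congrArg (coeff · (p - 2)) ha
  simp only [finsetSum_coeff, coeff_C_mul, coeff_X_pow, h0, mul_zero, mul_ite, mul_one] at this
  rw [Finset.sum_ite_eq, if_pos (Finset.mem_range.mpr (by lia))] at this
  exact pow_ne_zero _ hκ0 this

/-- The quotient of the extreme coefficients of a factor of `Φ_k` over `ℂ` is a root of unity. -/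
theorem coeff_zero_div_leadingCoeff_pow_eq_one {k : ℕ} (hk : 0 < k) {f : ℂ[X]} {c : ℂ}
    (hc : c ≠ 0) (hf : f ∣ C c * cyclotomic k ℂ) {M : ℕ} (hM : Even M) (hkM : k ∣ M) :
    ∃ w : ℂ, w ^ M = 1 ∧ f.coeff 0 = w * f.leadingCoeff := by
  have hroots : f.roots.prod ^ M = 1 := by
    refine Multiset.prod_induction (fun r : ℂ => r ^ M = 1) f.roots
      (fun a b ha hb => by rw [mul_pow, ha, hb, one_mul]) (one_pow M) fun r hr => ?_
    have hr0 : (C c * cyclotomic k ℂ).IsRoot r := (isRoot_of_mem_roots hr).dvd hf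
    rw [IsRoot, eval_mul, eval_C] at hr0
    have : NeZero (k : ℂ) := ⟨by exact_mod_cast hk.ne'⟩
    have hprim : IsPrimitiveRoot r k :=
      isRoot_cyclotomic_iff.mp ((mul_eq_zero.mp hr0).resolve_left hc)
    obtain ⟨l, rfl⟩ := hkM
    rw [pow_mul, hprim.pow_eq_one, one_pow]
  refine ⟨(-1) ^ f.natDegree * f.roots.prod, ?_, ?_⟩
  · rw [mul_pow, hroots, mul_one, ← pow_mul, mul_comm, pow_mul, hM.neg_one_pow, one_pow]
  · rw [(IsAlgClosed.splits f).coeff_zero_eq_leadingCoeff_mul_prod_roots]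
    ring

/-- The complex factor u + sy of cΦ_k has leading coefficient ε + z and constant term -1 + εz, where
z = s · `y.coeff d`. Their quotient w is a root of unity, and z² being rational makes w quadratic.
Hence w = ±1, and only w = -ε, z = 0 is consistent. -/
theorem coeff_eq_zero_of_middle_binomial {k p d D : ℕ} {s : ℂ} {y : ℚ[X]} {ε c : ℚ}
    (hk : 0 < k) (hp : p.Prime) (hp5 : 5 ≤ p) (hkp : k ∣ 2 * p) (hd : 0 < d)
    (hD : 0 < D) (hs : s ^ 2 = -(D : ℂ)) (hε : ε ^ 2 = 1) (hy : y.natDegree ≤ d)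
    (hrefl : reflect d y = C ε * y) (hc : c ≠ 0)
    (h : (C ε * X ^ d - 1) ^ 2 + C (D : ℚ) * y ^ 2 = C c * cyclotomic k ℚ) :
    y.coeff d = 0 := by
  have hε0 : ε ≠ 0 := by rintro rfl; norm_num at hε
  have hε' : (ε : ℂ) ^ 2 = 1 := by exact_mod_cast hε
  have hy0 : y.coeff 0 = ε * y.coeff d := by
    have := congrArg (coeff · 0) hrefl
    simp only [coeff_reflect, coeff_C_mul, revAt_le (Nat.zero_le d), Nat.sub_zero] at this
    rw [this, ← mul_assoc, ← pow_two, hε, one_mul]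
  set u : ℚ[X] := C ε * X ^ d - 1 with hu
  set φ := algebraMap ℚ ℂ with hφ
  set f : ℂ[X] := u.map φ + C s * y.map φ with hf
  set z : ℂ := s * (y.coeff d : ℂ) with hz
  have hz2 : z ^ 2 = -((D * y.coeff d ^ 2 : ℚ) : ℂ) := by
    rw [hz, mul_pow, hs]; push_cast; ring
  have hg : (0 : ℚ) ≤ D * y.coeff d ^ 2 := by positivity
  have hfd : f.coeff d = ε + z := by
    simp [hf, hu, hz, hφ, coeff_one, hd.ne']
  have hf0 : f.coeff 0 = -1 + ε * z := by
    simp [hf, hu, hz, hφ, hd.ne, hy0]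
    ring
  have hlead : (ε : ℂ) + z ≠ 0 := by
    intro h0
    have h1 : z ^ 2 = 1 := by rw [eq_neg_of_add_eq_zero_right h0, neg_sq, hε']
    rw [hz2] at h1
    have h2 : -(D * y.coeff d ^ 2 : ℚ) = 1 := by exact_mod_cast h1
    linarith
  have hdeg : f.natDegree = d := by
    refine natDegree_eq_of_le_of_coeff_ne_zero (natDegree_add_le_of_degree_le ?_ ?_)
      (by rwa [hfd])
    · exact natDegree_map_le.trans (natDegree_binomial hε0 hd).le
    · exact (natDegree_C_mul_le _ _).trans (natDegree_map_le.trans hy)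
  have hdvd : f ∣ C (c : ℂ) * cyclotomic k ℂ := by
    refine ⟨u.map φ - C s * y.map φ, ?_⟩
    have h1 := congrArg (map φ) h
    have h2 : (C s : ℂ[X]) ^ 2 = -C (D : ℂ) := by rw [← C_pow, hs, C_neg]
    simp only [Polynomial.map_add, Polynomial.map_mul, Polynomial.map_pow, map_C, map_cyclotomic,
      map_natCast, Polynomial.map_natCast] at h1
    rw [show φ c = (c : ℂ) from eq_ratCast φ c] at h1
    simp only [map_natCast] at h2
    rw [← h1, hf]
    linear_combination (y.map φ) ^ 2 * h2
  obtain ⟨w, hw, hw0⟩ := coeff_zero_div_leadingCoeff_pow_eq_one hk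
    (c := (c : ℂ)) (by exact_mod_cast hc) hdvd (even_two_mul p) hkp
  rw [leadingCoeff, hdeg, hfd, hf0] at hw0
  have hlin : (w + ε : ℂ) = -ε * (z * (w - ε)) := by
    linear_combination -w * hε' - (ε : ℂ) * hw0
  have hquad : (w + ε : ℂ) ^ 2 = -((D * y.coeff d ^ 2 : ℚ) : ℂ) * (w - ε) ^ 2 := by
    rw [hlin, ← hz2]
    linear_combination z ^ 2 * (w - ε) ^ 2 * hε'
  have hw2 := sq_eq_one_of_quadratic hp hp5 hw hg hε hquad
  have hw' : (w - ε : ℂ) * (w + ε) = 0 := by linear_combination hw2 - hε'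
  have hεC : (ε : ℂ) ≠ 0 := by exact_mod_cast hε0
  rcases mul_eq_zero.mp hw' with h1 | h1
  · rw [h1, mul_zero, mul_zero, sub_eq_zero.mp h1, ← two_mul] at hlin
    exact absurd hlin (mul_ne_zero two_ne_zero hεC)
  · rw [h1, eq_comm] at hlin
    have hne : (w - ε : ℂ) ≠ 0 := by
      rw [eq_neg_of_add_eq_zero_left h1]
      intro h2
      exact mul_ne_zero two_ne_zero hεC (by linear_combination -h2)
    have hz0 : z = 0 :=
      (mul_eq_zero.mp ((mul_eq_zero.mp hlin).resolve_left (neg_ne_zero.mpr hεC))).resolve_right hne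
    have hs0 : s ≠ 0 := by
      rintro rfl
      have : (D : ℂ) = 0 := by linear_combination hs
      exact hD.ne' (by exact_mod_cast this)
    exact_mod_cast (mul_eq_zero.mp hz0).resolve_left hs0

theorem middle_binomial_absurd {k p d D : ℕ} {ζ s : ℂ} {y : ℚ[X]} {ε c : ℚ}
    (hζ : IsPrimitiveRoot ζ k) (hk : 2 < k) (hp : p.Prime) (hp5 : 5 ≤ p) (hkp : k ∣ 2 * p)
    (hφ : k.totient = 2 * d) (hpd : p = 2 * d + 1) (hD : 0 < D) (hs : s ^ 2 = -(D : ℂ))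
    (hε : ε ^ 2 = 1) (hy : y.natDegree ≤ d) (hrefl : reflect d y = C ε * y) (hc : c ≠ 0)
    (h : (C ε * X ^ d - 1) ^ 2 + C (D : ℚ) * y ^ 2 = C c * cyclotomic k ℚ) : False := by
  have hyd := coeff_eq_zero_of_middle_binomial (by lia) hp hp5 hkp (by lia) hD hs hε hy hrefl hc h
  have hyd' : y.natDegree ≤ d - 1 := by
    have hne : y.natDegree ≠ d := by
      intro h0
      rw [← h0, coeff_natDegree, leadingCoeff_eq_zero] at hyd
      rw [hyd, natDegree_zero] at h0
      lia
    lia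
  have hζp : ∃ κ : ℚ, κ ^ 2 = 1 ∧ ζ ^ p = κ := by
    have h1 : ζ ^ p * ζ ^ p = 1 := by
      rw [← pow_add, ← two_mul]; exact (hζ.pow_eq_one_iff_dvd _).mpr hkp
    rcases mul_self_eq_one_iff.mp h1 with h1 | h1
    · exact ⟨1, by norm_num, by simpa using h1⟩
    · exact ⟨-1, by norm_num, by simpa using h1⟩
  obtain ⟨κ, hκ, hζκ⟩ := hζp
  have hcoeff := cyclotomic_coeff_sub_two_ne_zero hζ hk ⟨d, hpd⟩ (by lia) (by lia) hκ hζκ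
  have h1 := congrArg (coeff · (p - 2)) h
  have h2 : (C ε * X ^ d - 1 : ℚ[X]) ^ 2 = C (ε ^ 2) * X ^ (2 * d) - C (2 * ε) * X ^ d + 1 := by
    simp only [C_mul, C_pow, map_ofNat]
    ring
  -- The degree is at most 2(d - 1) = p - 3.
  have h3 : (C (D : ℚ) * y ^ 2).coeff (p - 2) = 0 := by
    refine coeff_eq_zero_of_natDegree_lt ((natDegree_C_mul_le _ _).trans_lt ?_)
    exact (natDegree_pow_le_of_le 2 hyd').trans_lt (by lia)
  simp only [h2, coeff_add, coeff_sub, h3, coeff_C_mul, coeff_X_pow, coeff_one] at h1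
  rw [if_neg (by lia), if_neg (by lia), if_neg (by lia)] at h1
  simp only [mul_zero, sub_zero, add_zero] at h1
  exact mul_ne_zero hc hcoeff h1.symm

/-! ### Monomial form of t - 1, the case φ(k) = 2, and the arithmetic of k -/

/-- A primitive `k`-th root of unity which is represented by a polynomial of degree at most
`φ(k) / 2` is represented by a signed monomial. -/
theorem eq_signed_monomial {k d N i : ℕ} {ζ : ℂ} {v : ℚ[X]} (hζ : IsPrimitiveRoot ζ k)
    (hk : 2 < k) (hφ : k.totient = 2 * d) (hN : k = N ∨ k = 2 * N) (hNd : N ≤ 3 * d)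
    (hcop : d.Coprime N → N < 3 * d) (hi : i.Coprime k) (hv : v.natDegree ≤ d)
    (hvi : aeval ζ v = ζ ^ i) :
    ∃ (e : ℕ) (ε : ℚ), 0 < e ∧ e ≤ d ∧ ε ^ 2 = 1 ∧ e.Coprime N ∧ v = C ε * X ^ e := by
  have hNk : N ∣ k := by rcases hN with h | h <;> rw [h]; exact Dvd.intro_left 2 rfl
  have hζN : ∃ κ : ℚ, κ ^ 2 = 1 ∧ ζ ^ N = κ := by
    have h1 : ζ ^ N * ζ ^ N = 1 := by
      rw [← pow_add, ← two_mul]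
      exact (hζ.pow_eq_one_iff_dvd _).mpr
        (by rcases hN with h | h <;> rw [h]; exact Dvd.intro_left 2 rfl)
    rcases mul_self_eq_one_iff.mp h1 with h1 | h1
    · exact ⟨1, by norm_num, by simpa using h1⟩
    · exact ⟨-1, by norm_num, by simpa using h1⟩
  obtain ⟨κ, hκ, hζκ⟩ := hζN
  have hN0 : 0 < N := by lia
  have heN : (i % N).Coprime N := by
    rw [Nat.Coprime, (Nat.mod_modEq i N).gcd_eq]
    exact hi.coprime_dvd_right hNk
  have he : i % N < N := Nat.mod_lt _ hN0
  have hvε : aeval ζ v = ((κ ^ (i / N) : ℚ) : ℂ) * ζ ^ (i % N) := by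
    conv_lhs => rw [hvi, ← Nat.div_add_mod i N, pow_add, pow_mul, hζκ]
    push_cast; rfl
  have hε : (κ ^ (i / N)) ^ 2 = 1 := by rw [← pow_mul, mul_comm, pow_mul, hκ, one_pow]
  set e := i % N
  set ε := κ ^ (i / N)
  have hε0 : ε ≠ 0 := by intro h; rw [h] at hε; norm_num at hε
  have hκ0 : κ ≠ 0 := by intro h; rw [h] at hκ; norm_num at hκ
  have he0 : 0 < e := by
    rcases Nat.eq_zero_or_pos e with h0 | h0
    · rw [h0, Nat.coprime_zero_left] at heN
      lia
    · exact h0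
  rcases lt_or_ge e (2 * d) with hlt | hge
  · have hv' : v = C ε * X ^ e := by
      refine sub_eq_zero.mp (eq_zero_of_aeval_primitiveRoot_eq_zero hζ (by lia) ?_ ?_)
      · refine (natDegree_sub_le _ _).trans_lt (max_lt (by lia) ?_)
        exact (natDegree_C_mul_X_pow_le _ _).trans_lt (by lia)
      · simp [hvε]
    refine ⟨e, ε, he0, ?_, hε, heN, hv'⟩
    rwa [hv', natDegree_C_mul_X_pow _ _ hε0] at hv
  · exfalso
    rcases lt_or_ge (N - e) d with h1 | h1
    -- Since ζ^N = κ, multiplying by ζ^(N-e) turns v(ζ) into a constant; the degree stays below 2d,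
    -- so this is a polynomial identity, false at 0.
    · have h0 : X ^ (N - e) * v - C (ε * κ) = 0 := by
        refine eq_zero_of_aeval_primitiveRoot_eq_zero hζ (by lia) ?_ ?_
        · refine (natDegree_sub_le _ _).trans_lt (max_lt ?_ (by rw [natDegree_C]; lia))
          exact (natDegree_mul_le_of_le (natDegree_X_pow_le _) hv).trans_lt (by lia)
        · simp only [map_sub, map_mul, map_pow, aeval_X, aeval_C, hvε, eq_ratCast,
            ← hζκ]
          have : ζ ^ N = ζ ^ (N - e) * ζ ^ e := by rw [← pow_add, Nat.sub_add_cancel he.le]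
          rw [this]
          ring
      have h2 := congrArg (eval 0) h0
      simp only [eval_sub, eval_mul, eval_pow, eval_X, eval_C, eval_zero,
        zero_pow (Nat.sub_ne_zero_of_lt he), zero_mul, zero_sub, neg_eq_zero] at h2
      exact mul_ne_zero hε0 hκ0 h2
    -- The boundary case e = 2d, N = 3d, where d would be prime to N.
    · have h2 : N - e = d := by lia
      have := hcop (h2 ▸ (Nat.coprime_self_sub_left he.le).mpr heN)
      lia

/-- The field `ℚ(ζ_k)` is imaginary quadratic when `φ(k) = 2`; then `t` and `y` are proportional
and `t ^ 2 + D y ^ 2` is reducible. -/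
theorem not_irreducible_of_totient_eq_two {k D : ℕ} {ζ s η : ℂ} {t y : ℚ[X]}
    (hζ : IsPrimitiveRoot ζ k) (hk : 2 < k) (hD : 0 < D) (hs : s ^ 2 = -(D : ℂ))
    (hη : ‖η‖ = 1) (ht : t.natDegree ≤ 1) (hy : y.natDegree ≤ 1) (htη : aeval ζ t = η + 1)
    (hyη : aeval ζ y * s = η - 1)
    (hdeg : (C (1 / 4 : ℚ) * (t ^ 2 + C (D : ℚ) * y ^ 2)).natDegree = 2) :
    ¬ Irreducible (C (1 / 4 : ℚ) * (t ^ 2 + C (D : ℚ) * y ^ 2)) := by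
  intro hirr
  obtain ⟨β, α, rfl⟩ : ∃ β α, t = C α * X + C β :=
    ⟨_, _, eq_X_add_C_of_natDegree_le_one ht⟩
  obtain ⟨β', α', rfl⟩ : ∃ β' α', y = C α' * X + C β' :=
    ⟨_, _, eq_X_add_C_of_natDegree_le_one hy⟩
  simp only [map_add, map_mul, aeval_C, aeval_X, eq_ratCast] at htη hyη
  have hs0 : s ≠ 0 := by
    rintro rfl
    have : (D : ℂ) = 0 := by linear_combination hs
    exact hD.ne' (by exact_mod_cast this)
  have hcs := conj_eq_neg_of_sq hs hD
  have hηη : η * conj η = 1 := by rw [Complex.mul_conj']; simp [hη]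
  have htη' := congrArg conj htη
  have hyη' := congrArg conj hyη
  simp only [map_add, map_mul, map_sub, map_one, map_ratCast, hcs] at htη' hyη'
  have hζζ : ζ - conj ζ ≠ 0 := by
    intro h0
    have h1 : ζ * conj ζ = 1 := by
      rw [Complex.mul_conj', hζ.norm'_eq_one (by lia)]; simp
    rw [← sub_eq_zero.mp h0, ← pow_two] at h1
    have := Nat.le_of_dvd two_pos (hζ.dvd_of_pow_eq_one _ h1)
    lia
  -- The ratio t(ζ)/y(ζ) = s(η + 1)/(η - 1) is real, both factors changing sign under conjugation;
  -- the combination clears denominators.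
  have hdet : α * β' - α' * β = 0 := by
    have h1 : ((α * β' - α' * β : ℚ) : ℂ) * ((ζ - conj ζ) * s) = 0 := by
      push_cast
      linear_combination -(α' * conj ζ + β') * (-s) * htη - (η + 1) * hyη'
        - (α' * ζ + β') * s * htη' - (conj η + 1) * hyη - 2 * hηη
    exact_mod_cast (mul_eq_zero.mp h1).resolve_right (mul_ne_zero hζζ hs0)
  have hroot : ∃ x : ℚ, α * x + β = 0 ∧ α' * x + β' = 0 := by
    by_cases hα : α = 0
    · by_cases hα' : α' = 0
      · subst hα hα'
        have : (C (1 / 4 : ℚ) * ((C 0 * X + C β) ^ 2 + C (D : ℚ) * (C 0 * X + C β') ^ 2)) =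
            C (1 / 4 * (β ^ 2 + D * β' ^ 2)) := by
          simp
        rw [this, natDegree_C] at hdeg
        lia
      · subst hα
        have hβ : β = 0 := by
          have : α' * β = 0 := by linarith
          exact (mul_eq_zero.mp this).resolve_left hα'
        exact ⟨-β' / α', by simp [hβ], by field_simp; ring⟩
    · refine ⟨-β / α, by field_simp; ring, ?_⟩
      field_simp
      linarith
  obtain ⟨x, hx, hx'⟩ := hroot
  have := degree_eq_one_of_irreducible_of_root hirr (x := x) (by
    simp [IsRoot, hx, hx'])
  rw [degree_eq_natDegree hirr.ne_zero, hdeg] at this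
  norm_num at this

/-- N is chosen with ζ^N = ±1. Unless N = p, the numbers d and N share the factor 2 or p. -/
theorem exists_half_modulus {k m n p d : ℕ} (hp : p.Prime) (hodd : Odd p)
    (hk : k = 2 ^ m * p ^ n) (hφ : k.totient = 2 * d) (hd : 2 ≤ d) :
    ∃ N, (k = N ∨ k = 2 * N) ∧ N ≤ 3 * d ∧ (d.Coprime N → N = p ∧ 5 ≤ p ∧ p = 2 * d + 1) := by
  have hp3 : 3 ≤ p := by
    have := hp.two_le
    obtain ⟨l, hl⟩ := hodd
    lia
  obtain ⟨l, hl⟩ := hodd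
  have hcop : ∀ m n, (2 ^ m).Coprime (p ^ n) := fun m n =>
    Nat.Coprime.pow _ _ ((Nat.coprime_primes Nat.prime_two hp).mpr (by lia))
  have hφ2 : ∀ m, (2 ^ (m + 1)).totient = 2 ^ m := fun m => by
    rw [Nat.totient_prime_pow_succ Nat.prime_two]; simp
  have hφp : ∀ n, (p ^ (n + 1)).totient = p ^ n * (2 * l) := fun n => by
    rw [Nat.totient_prime_pow_succ hp, hl]; simp
  rw [hk, Nat.totient_mul (hcop m n)] at hφ
  rcases n with _ | n
  · rw [pow_zero, Nat.totient_one, mul_one] at hφ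
    rcases m with _ | _ | _ | m
    · simp at hφ; lia
    · simp at hφ; lia
    · rw [hφ2] at hφ; lia
    · rw [hφ2] at hφ
      have hd' : d = 2 * 2 ^ m := by rw [pow_succ, pow_succ] at hφ; lia
      refine ⟨4 * 2 ^ m, .inr (by rw [hk]; ring), by lia, fun hc => ?_⟩
      have := Nat.le_of_dvd one_pos (hc.gcd_eq_one ▸ Nat.dvd_gcd
        ⟨_, hd'⟩ ⟨2 * 2 ^ m, by ring⟩ : 2 ∣ 1)
      lia
  · rw [hφp] at hφ
    have hpow : p ^ (n + 1) = p ^ n * (2 * l + 1) := by rw [pow_succ, ← hl]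
    have hppos : 0 < p ^ n := Nat.pos_of_ne_zero (pow_ne_zero _ hp.ne_zero)
    have small : ∀ (_ : (2 ^ m).totient = 1), d = p ^ n * l := fun h1 => by
      rw [h1] at hφ; lia
    have key : d = p ^ n * l → p ^ (n + 1) ≤ 3 * d ∧
        (d.Coprime (p ^ (n + 1)) → p ^ (n + 1) = p ∧ 5 ≤ p ∧ p = 2 * d + 1) := fun h1 => by
      refine ⟨?_, fun hc => ?_⟩
      · rw [hpow, h1]
        nlinarith
      · rcases n with _ | n
        · simp only [pow_zero, one_mul, zero_add, pow_one] at h1 ⊢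
          lia
        · have := Nat.le_of_dvd one_pos (hc.gcd_eq_one ▸ Nat.dvd_gcd
            ⟨p ^ n * l, by rw [h1]; ring⟩ ⟨p ^ (n + 1), by ring⟩ : p ∣ 1)
          lia
    rcases m with _ | _ | m
    · exact ⟨p ^ (n + 1), .inl (by simpa using hk), key (small (by simp))⟩
    · exact ⟨p ^ (n + 1), .inr (by simpa using hk), key (small (by simp))⟩
    · rw [hφ2, pow_succ] at hφ
      have hd' : d = 2 * (2 ^ m * p ^ n * l) := by
        have : 2 * d = 2 * (2 * (2 ^ m * p ^ n * l)) := by rw [← hφ]; ring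
        lia
      refine ⟨2 ^ (m + 1) * p ^ (n + 1), .inr (by rw [hk]; ring), ?_, fun hc => ?_⟩
      · have h2 : 0 < 2 ^ m * p ^ n := by positivity
        have : 2 ^ (m + 1) * p ^ (n + 1) = 2 * (2 ^ m * p ^ n * (2 * l + 1)) := by
          rw [hpow]; ring
        rw [this, hd']
        nlinarith
      · have := Nat.le_of_dvd one_pos (hc.gcd_eq_one ▸ Nat.dvd_gcd ⟨_, hd'⟩
          ⟨2 ^ m * p ^ (n + 1), by ring⟩ : 2 ∣ 1)
        lia

/-! ### Transport to ℂ and assembly -/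

/-- The Brezing–Weng data, transported to `ℂ`. -/
theorem exists_complex_construction {k D : ℕ} {t q : ℚ[X]} (hk : 0 < k)
    (h : IsBrezingWengFamily k D t (cyclotomic k ℚ) q) :
    ∃ (ζ η s : ℂ) (y : ℚ[X]), IsPrimitiveRoot ζ k ∧ IsPrimitiveRoot η k ∧ s ^ 2 = -(D : ℂ) ∧
      aeval ζ t = η + 1 ∧ t.degree < (cyclotomic k ℚ).degree ∧
      aeval ζ y * s = η - 1 ∧ y.degree < (cyclotomic k ℚ).degree ∧
      q = C (1 / 4 : ℚ) * (t ^ 2 + C (D : ℚ) * y ^ 2) := by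
  obtain ⟨η, s, y, hη, hs, ht, htd, hy, hyd, hq, -⟩ := h.construction
  have hζ := Complex.isPrimitiveRoot_exp k hk.ne'
  set ζ := Complex.exp (2 * Real.pi * Complex.I / k)
  have h0 : eval₂ (algebraMap ℚ ℂ) ζ (cyclotomic k ℚ) = 0 := by
    rw [cyclotomic_eq_minpoly_rat hζ hk, ← aeval_def, minpoly.aeval]
  have : Fact (Irreducible (cyclotomic k ℚ)) := ⟨cyclotomic.irreducible_rat hk⟩
  set f : AdjoinRoot (cyclotomic k ℚ) →+* ℂ := AdjoinRoot.lift (algebraMap ℚ ℂ) ζ h0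
  have hf : ∀ P : ℚ[X], f (AdjoinRoot.mk _ P) = aeval ζ P := fun P => AdjoinRoot.lift_mk h0 P
  refine ⟨ζ, f η, f s, y, hζ, hη.map_of_injective f.injective, ?_, ?_, htd, ?_, hyd, hq⟩
  · rw [← map_pow, hs, map_neg, map_natCast]
  · rw [← hf, ht, map_add, map_one]
  · rw [← hf, ← map_mul, hy, map_sub, map_one]

theorem rhoValue_ne_one_of_cyclotomic {k m n p D : ℕ} (hp : p.Prime) (hp_odd : Odd p)
    (hk : k = 2 ^ m * p ^ n) (hD : Squarefree D) {t r q : ℚ[X]}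
    (hfam : IsCyclotomicFamily k D t r q) (hr : r = cyclotomic k ℚ) :
    rhoValue t r q ≠ 1 := by
  subst hr
  have hk0 : 0 < k := hfam.1.k_pos
  have hD0 : 0 < D := Nat.pos_of_ne_zero hD.ne_zero
  obtain ⟨ζ, η, s, y, hζ, hη, hs, htη, htd, hyη, hyd, hq⟩ :=
    exists_complex_construction hk0 hfam.1
  have hq_irr := hfam.1.q_representsPrimes.irreducible
  intro hρ
  have hqdeg : q.natDegree = k.totient := by
    have hφ0 : (k.totient : ℚ) ≠ 0 := by exact_mod_cast (Nat.totient_pos.mpr hk0).ne'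
    rw [rhoValue, natDegree_cyclotomic, div_eq_one_iff_eq hφ0] at hρ
    exact_mod_cast hρ
  have hsum : (t ^ 2 + C (D : ℚ) * y ^ 2).natDegree = k.totient := by
    rw [← hqdeg, hq, natDegree_C_mul (by norm_num)]
  rcases le_or_gt k 2 with hk2 | hk2
  · have hφ1 : k.totient = 1 := by
      have : k = 1 ∨ k = 2 := by lia
      rcases this with rfl | rfl <;> simp
    obtain ⟨h1, h2⟩ := natDegree_le_of_natDegree_sq_add_le (d := 1) hD0 (hsum.trans_le (by lia))
    rw [degree_cyclotomic, hφ1] at htd hyd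
    rw [eq_C_of_degree_le_zero (Nat.WithBot.lt_one_iff_le_zero.mp htd),
      eq_C_of_degree_le_zero (Nat.WithBot.lt_one_iff_le_zero.mp hyd), ← C_pow, ← C_pow, ← C_mul, ← C_add,
      natDegree_C, hφ1] at hsum
    exact zero_ne_one hsum
  obtain ⟨d, hd⟩ := (Nat.totient_even hk2).two_dvd
  obtain ⟨ht, hy⟩ := natDegree_le_of_natDegree_sq_add_le hD0 (hsum.trans_le hd.le)
  rcases lt_or_ge d 2 with hd2 | hd2
  · have hd1 : d = 1 := by
      have := Nat.totient_pos.mpr hk0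
      lia
    subst hd1
    exact not_irreducible_of_totient_eq_two hζ hk2 hD0 hs (hη.norm'_eq_one hk0.ne') ht hy htη hyη
      (by rw [← hq, hqdeg, hd, mul_one]) (hq ▸ hq_irr)
  · obtain ⟨N, hN, hNd, hNcop⟩ := exists_half_modulus hp hp_odd hk hd hd2
    have : NeZero k := ⟨hk0.ne'⟩
    obtain ⟨i, -, hi, hiη⟩ := hζ.isPrimitiveRoot_iff.mp hη
    obtain ⟨e, ε, he, hed, hε, heN, hv⟩ := eq_signed_monomial hζ hk2 hd hN hNd
      -- Here N = 2d + 1 < 3d because d ≥ 2.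
      (fun hc => by have := hNcop hc; lia) hi (v := t - 1)
      ((natDegree_sub_le _ _).trans (max_le ht (by simp))) (by
        rw [map_sub, htη, map_one, hiη]; ring)
    have huy : aeval ζ (C ε * X ^ e - 1 : ℚ[X]) = s * aeval ζ y := by
      rw [← hv, map_sub, map_sub, htη, map_one, mul_comm, hyη]; ring
    obtain ⟨rfl, hrefl, c, hc, hcm⟩ :=
      eq_and_reflect_of_binomial hζ hk0 hd hD0 hs he hed hε hy huy
    -- With e = d, coprimality of e and N leaves only N = p.
    obtain ⟨rfl, hp5, hpd⟩ := hNcop heN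
    have hkp : k ∣ 2 * N := by
      rcases hN with h | h <;> rw [h]
      exact Dvd.intro_left 2 rfl
    exact middle_binomial_absurd hζ hk2 hp hp5 hkp hd hpd hD0 hs hε hy hrefl hc hcm

end PairingFriendly

theorem theorem2 (k m n p D : ℕ) (hp : p.Prime) (hp_odd : Odd p) (hk : k = 2 ^ m * p ^ n)
    (hD : Squarefree D) (t r q : Polynomial ℚ)
    (hfam : PairingFriendly.IsCyclotomicFamily k D t r q)
    (hr : r = Polynomial.cyclotomic k ℚ) :
    PairingFriendly.rhoValue t r q ≠ 1 := by
  exact PairingFriendly.rhoValue_ne_one_of_cyclotomic hp hp_odd hk hD hfam hr
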